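/- **Theorem.** For a matroid $\mathsf{N}$ on a finite ground set, let $\mathcal{L}(\mathsf{N})$ be its lattice of flats, ordered by inclusion, with least element $\widehat{0}$ and greatest element $\widehat{1}$. Its Bergman complex is the order complex of the proper part $\mathcal{L}(\mathsf{N})\setminus\{\widehat{0},\widehat{1}\}$, i.e. the simplicial complex whose faces are the finite chains (including the empty chain) of this poset. Let $h_{\mathsf{N}}(x)\in\mathbb{Z}[x]$ be its $h$-polynomial, where the $h$-polynomial of a finite simplicial complex of dimension $d-1$ with $f_{k-1}$ faces having exactly $k$ vertices is \[ \sum_{k=0}^{d} f_{k-1}\,x^{k}(1-x)^{d-k}; \] in particular it equals $1$ when the only face is the empty one ($d=0$, $f_{-1}=1$). Let $\mathsf{M}$ be a loopless matroid on a finite ground set $E$, and let $i\in E$ be an element that is not a coloop of $\mathsf{M}$. Put \[ \mathscr{S}_i=\{F\in\mathcal{L}(\mathsf{M}) : i\notin F,\ F\cup\{i\}\in\mathcal{L}(\mathsf{M})\}. \] Then \[ h_{\mathsf{M}}(x)=h_{\mathsf{M}\setminus i}(x)+x\sum_{F\in\mathscr{S}_i}h_{\mathsf{M}|F}(x)\,h_{\mathsf{M}/(F\cup\{i\})}(x),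 \] where $\mathsf{M}\setminus i$, $\mathsf{M}|F$ and $\mathsf{M}/(F\cup\{i\})$ denote deletion, restriction and contraction. -/

import Mathlib

open Polynomial

/-- The order complex of a poset `P`: its faces are the nonempty finite chains of `P`.
(In Mathlib's convention, the empty face is left implicit.) -/
def orderComplex (P : Type*) [PartialOrder P] : AbstractSimplicialComplex P where
  faces := {s | s.Nonempty ∧ IsChain (· ≤ ·) (s : Set P)}
  isRelLowerSet_faces := fun _ hs =>
    ⟨hs.1, fun _ hts ht => ⟨ht, hs.2.mono (Finset.coe_subset.mpr hts)⟩⟩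
  singleton_mem := fun v => ⟨Finset.singleton_nonempty v, by simp⟩

namespace AbstractSimplicialComplex

variable {V : Type*}

/-- All the faces of the simplicial complex `K`, including the empty face. -/
def allFaces (K : AbstractSimplicialComplex V) : Set (Finset V) :=
  insert ∅ K.faces

/-- The number `f_{k-1}(K)` of faces of `K` with exactly `k` vertices (meaningful for finite `K`);
`k = 0` counts the empty face. -/
noncomputable def fNumber (K : AbstractSimplicialComplex V) (k : ℕ) : ℕ :=
  {s ∈ K.allFaces | s.card = k}.ncard

/-- The largest number of vertices of a face of `K`, that is, `dim K + 1` (meaningful for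
finite-dimensional `K`); it is `0` when the only face is the empty one. -/
noncomputable def dimSucc (K : AbstractSimplicialComplex V) : ℕ :=
  sSup (Finset.card '' K.allFaces)

/-- The `h`-polynomial of a finite simplicial complex `K` of dimension `d - 1`:
`∑_{k = 0}^{d} f_{k-1}(K) x ^ k (1 - x) ^ (d - k)`. -/
noncomputable def hPolynomial (K : AbstractSimplicialComplex V) : ℤ[X] :=
  ∑ k ∈ Finset.range (K.dimSucc + 1),
    C (K.fNumber k : ℤ) * X ^ k * (1 - X) ^ (K.dimSucc - k)

end AbstractSimplicialComplex

namespace Matroid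

variable {α : Type*}

/-- The proper part of the lattice of flats of `M`: the flats other than the least flat (the set
of loops, i.e. the closure of `∅`) and the greatest flat (the ground set), ordered by inclusion. -/
abbrev ProperFlat (M : Matroid α) : Type _ :=
  {F : Set α // M.IsFlat F ∧ F ≠ M.loops ∧ F ≠ M.E}

/-- The Bergman complex of `M`: the order complex of the proper part of its lattice of flats. -/
def bergmanComplex (M : Matroid α) : AbstractSimplicialComplex M.ProperFlat :=
  orderComplex M.ProperFlat

/-- The `h`-polynomial of the Bergman complex of `M`. -/
noncomputable def bergmanHPolynomial (M : Matroid α) : ℤ[X] :=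
  M.bergmanComplex.hPolynomial

/-- The set of flats `F` of `M` with `i ∉ F` such that `F ∪ {i}` is also a flat. -/
def deletionFlats (M : Matroid α) (i : α) : Set (Set α) :=
  {F | M.IsFlat F ∧ i ∉ F ∧ M.IsFlat (insert i F)}

/-- A matroid on a finite ground set has only finitely many flats, so that sums over
`M.deletionFlats i` are finite sums. -/
theorem finite_deletionFlats (M : Matroid α) [M.Finite] (i : α) : (M.deletionFlats i).Finite :=
  M.ground_finite.finite_subsets.subset fun _ hF => hF.1.subset_ground

end Matroid

open scoped Matroid

/-!
The `h`-polynomial of a complex of chains is a weighted count of chains: a chain with `k` elements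
contributes `x ^ k (1 - x) ^ (d - k)`. For the Bergman complex of `M` the number `d` is
`rank M - 1`, because a chain of proper flats has strictly increasing ranks strictly between `0`
and `rank M`, and any flat of positive corank can be enlarged to one of rank one more
(`Matroid.bergmanHPolynomial_eq_chainSum`). The identity is then obtained by splitting the set of
chains of proper flats of `M`.

Call a flat `G` *exceptional* if `i ∈ G` and `G \ {i}` is again a flat; the exceptional flats are
the sets `F ∪ {i}` with `F ∈ 𝒮ᵢ`, and they are proper since `i` is not a coloop.

* A flat is not exceptional exactly when it is the closure of its trace on `M.E \ {i}`, so `closure`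
  is an order isomorphism from the flats of `M ＼ {i}` to the non-exceptional flats of `M`. As `i`
  is not a coloop, `M ＼ {i}` has the rank of `M`. Hence the chains without exceptional members
  contribute the `h`-polynomial of `M ＼ {i}` (`Matroid.bergmanHPolynomial_delete`).
* A chain with an exceptional member is sorted by its least one, `F ∪ {i}`
  (`chainSum_eq_add_sum`). The members above it form an arbitrary chain of proper flats of
  `M ／ (F ∪ {i})`. A flat strictly below `F ∪ {i}` that contains `i` is exceptional, so the members
  below form an arbitrary chain of nonempty flats contained in `F`, where `F` itself is allowed.
  Allowing the top element `F` amounts to passing to a cone, which does not change the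
  `h`-polynomial (`chainSum_insert_top`). With `F ∪ {i}` contributing the factor `x`, and since
  `rank M - 1 = rank F + 1 + (rank M - rank (F ∪ {i}) - 1)`, these chains contribute the summand
  of `F`.

Weighting by `(1 - x) ^ (d - k)` with truncated subtraction is harmless as long as all chains have
at most `d` elements; this is the purpose of the cardinality hypotheses below.
-/

/-! ### Weighted counts of chains in a finite poset -/

section ChainSum

variable {β γ : Type*} [PartialOrder β] [PartialOrder γ]

open scoped Classical in
/-- The finite chains, including the empty one, all of whose members lie in `A`. -/
noncomputable def chains (A : Finset β) : Finset (Finset β) :=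
  A.powerset.filter fun s => IsChain (· ≤ ·) (s : Set β)

lemma mem_chains {A s : Finset β} : s ∈ chains A ↔ s ⊆ A ∧ IsChain (· ≤ ·) (s : Set β) := by
  simp [chains]

/-- The sum of `x ^ k (1 - x) ^ (d - k)` over the chains in `A`, where `k` is the number of members
of the chain. It is the `h`-polynomial of the order complex of `A` if `d` is the largest number of
members of a chain in `A`; for chains with more than `d` members the exponent `d - k` is truncated
to `0`. -/
noncomputable def chainSum (A : Finset β) (d : ℕ) : ℤ[X] :=
  ∑ s ∈ chains A, X ^ s.card * (1 - X) ^ (d - s.card)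

lemma chainSum_empty (d : ℕ) : chainSum (∅ : Finset β) d = (1 - X) ^ d := by
  have : chains (∅ : Finset β) = {∅} := by
    ext s; simp +contextual [mem_chains]
  simp [chainSum, this]

/-- `chainSum` is invariant under order isomorphisms. -/
lemma chainSum_image [DecidableEq γ] {A : Finset β} {f : β → γ}
    (hf : ∀ x ∈ A, ∀ y ∈ A, f x ≤ f y ↔ x ≤ y) (d : ℕ) :
    chainSum (A.image f) d = chainSum A d := by
  have hinj : Set.InjOn f A := fun x hx y hy h =>
    le_antisymm ((hf x hx y hy).1 h.le) ((hf y hy x hx).1 h.ge)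
  symm
  refine Finset.sum_bij (fun s _ => s.image f) ?_ ?_ ?_ ?_
  · simp only [mem_chains, Finset.coe_image]
    rintro s ⟨hs, hc⟩
    refine ⟨Finset.image_subset_image hs, ?_⟩
    rintro _ ⟨x, hx, rfl⟩ _ ⟨y, hy, rfl⟩ -
    change f x ≤ f y ∨ f y ≤ f x
    rw [hf x (hs hx) y (hs hy), hf y (hs hy) x (hs hx)]
    exact hc.total hx hy
  · simp only [mem_chains]
    rintro s ⟨hs, -⟩ t ⟨ht, -⟩ h
    rw [← Finset.coe_inj, Finset.coe_image, Finset.coe_image] at h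
    exact Finset.coe_injective ((hinj.image_eq_image_iff
      (Finset.coe_subset.2 hs) (Finset.coe_subset.2 ht)).1 h)
  · simp only [mem_chains]
    rintro t ⟨ht, hc⟩
    obtain ⟨s, hs, rfl⟩ := Finset.subset_image_iff.1 ht
    refine ⟨s, ⟨hs, fun x hx y hy _ => ?_⟩, rfl⟩
    change x ≤ y ∨ y ≤ x
    rw [← hf x (hs hx) y (hs hy), ← hf y (hs hy) x (hs hx)]
    exact hc.total (by simpa using ⟨x, hx, rfl⟩) (by simpa using ⟨y, hy, rfl⟩)
  · simp only [mem_chains]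
    rintro s ⟨hs, -⟩
    rw [Finset.card_image_of_injOn (hinj.mono (Finset.coe_subset.2 hs))]

lemma isChain_union_insert {a b : Set β} {x : β} (ha : IsChain (· ≤ ·) a) (hb : IsChain (· ≤ ·) b)
    (hax : ∀ y ∈ a, y < x) (hxb : ∀ y ∈ b, x < y) : IsChain (· ≤ ·) (a ∪ insert x b) := by
  rintro y (hy | rfl | hy) z (hz | rfl | hz) hne
  · exact ha hy hz hne
  · exact .inl (hax y hy).le
  · exact .inl ((hax y hy).trans (hxb z hz)).le
  · exact .inr (hax z hz).le
  · exact absurd rfl hne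
  · exact .inl (hxb z hz).le
  · exact .inr ((hax z hz).trans (hxb y hy)).le
  · exact .inr (hxb y hy).le
  · exact hb hy hz hne

/-- If all of `L` is below `x` and all of `U` is above `x`, then a chain through `x` in
`L ∪ {x} ∪ U` is freely assembled from a chain in `L` and a chain in `U`. -/
lemma sum_chains_through [DecidableEq β] (L U : Finset β) (x : β) (d₁ d₂ : ℕ)
    (hL : ∀ y ∈ L, y < x) (hU : ∀ y ∈ U, x < y)
    (h₁ : ∀ s ∈ chains L, s.card ≤ d₁)
    (h₂ : ∀ s ∈ chains U, s.card ≤ d₂) :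
    ∑ s ∈ chains (L ∪ insert x U) with x ∈ s,
      (X : ℤ[X]) ^ s.card * (1 - X) ^ (d₁ + 1 + d₂ - s.card) =
    X * (chainSum L d₁ * chainSum U d₂) := by
  have hxL : x ∉ L := fun h => (hL x h).false
  have hxU : x ∉ U := fun h => (hU x h).false
  classical
  have hLU : Disjoint L U := Finset.disjoint_left.2 fun y hy hy' =>
    ((hL y hy).trans (hU y hy')).false
  rw [chainSum, chainSum, Finset.sum_mul_sum, ← Finset.sum_product', Finset.mul_sum]
  symm
  refine Finset.sum_nbij' (fun p => p.1 ∪ insert x p.2)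
    (fun s => (s.filter (· < x), s.filter (x < ·))) ?_ ?_ ?_ ?_ ?_
  · simp only [Finset.mem_product, Finset.mem_filter, mem_chains, Prod.forall, and_assoc]
    rintro a b ⟨ha, hac, hb, hbc⟩
    refine ⟨Finset.union_subset_union ha (Finset.insert_subset_insert x hb), ?_, by simp⟩
    push_cast
    exact isChain_union_insert hac hbc (fun y hy => hL y (ha hy)) (fun y hy => hU y (hb hy))
  · simp only [Finset.mem_product, Finset.mem_filter, mem_chains, and_assoc]
    rintro s ⟨hs, hc, -⟩
    refine ⟨fun y hy => ?_, hc.mono (Finset.coe_subset.2 (Finset.filter_subset _ _)),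
      fun y hy => ?_, hc.mono (Finset.coe_subset.2 (Finset.filter_subset _ _))⟩
    · obtain ⟨hy, hlt⟩ := Finset.mem_filter.1 hy
      rcases Finset.mem_union.1 (hs hy) with h | h
      · exact h
      · rcases Finset.mem_insert.1 h with rfl | h
        · exact absurd hlt (lt_irrefl _)
        · exact absurd hlt (hU y h).not_gt
    · obtain ⟨hy, hlt⟩ := Finset.mem_filter.1 hy
      rcases Finset.mem_union.1 (hs hy) with h | h
      · exact absurd hlt (hL y h).not_gt
      · rcases Finset.mem_insert.1 h with rfl | h
        · exact absurd hlt (lt_irrefl _)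
        · exact h
  · simp only [Finset.mem_product, mem_chains, Prod.forall]
    rintro a b ⟨⟨ha, -⟩, hb, -⟩
    ext y
    · simp only [Finset.mem_filter, Finset.mem_union, Finset.mem_insert]
      refine ⟨?_, fun h => ⟨.inl h, hL y (ha h)⟩⟩
      rintro ⟨h | rfl | h, hlt⟩
      · exact h
      · exact absurd hlt (lt_irrefl _)
      · exact absurd hlt (hU y (hb h)).not_gt
    · simp only [Finset.mem_filter, Finset.mem_union, Finset.mem_insert]
      refine ⟨?_, fun h => ⟨.inr (.inr h), hU y (hb h)⟩⟩
      rintro ⟨h | rfl | h, hlt⟩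
      · exact absurd hlt (hL y (ha h)).not_gt
      · exact absurd hlt (lt_irrefl _)
      · exact h
  · simp only [Finset.mem_filter, mem_chains, and_assoc]
    rintro s ⟨-, hc, hx⟩
    ext y
    simp only [Finset.mem_filter, Finset.mem_union, Finset.mem_insert]
    refine ⟨by rintro (h | rfl | h); exacts [h.1, hx, h.1], fun hy => ?_⟩
    rcases hc.total hy hx with h | h
    · rcases h.eq_or_lt with rfl | h
      · exact .inr (.inl rfl)
      · exact .inl ⟨hy, h⟩
    · rcases h.eq_or_lt with rfl | h
      · exact .inr (.inl rfl)
      · exact .inr (.inr ⟨hy, h⟩)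
  · simp only [Finset.mem_product, mem_chains, Prod.forall]
    rintro a b ⟨⟨ha, hac⟩, hb, hbc⟩
    have hcard : (a ∪ insert x b).card = a.card + (b.card + 1) := by
      rw [Finset.card_union_of_disjoint, Finset.card_insert_of_notMem (fun h => hxU (hb h))]
      rw [Finset.disjoint_insert_right]
      exact ⟨fun h => hxL (ha h), Finset.disjoint_of_subset_left ha
        (Finset.disjoint_of_subset_right hb hLU)⟩
    have := h₁ a (mem_chains.2 ⟨ha, hac⟩)
    have := h₂ b (mem_chains.2 ⟨hb, hbc⟩)
    rw [hcard, show d₁ + 1 + d₂ - (a.card + (b.card + 1)) = (d₁ - a.card) + (d₂ - b.card) by omega]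
    ring

/-- The `h`-polynomial of a cone is that of its base: each chain `s` in `A` gives the two chains `s`
and `s ∪ {x}`, whose weights differ by the factors `1 - x` and `x` from the weight of `s`. -/
lemma chainSum_insert_top [DecidableEq β] {A : Finset β} {x : β} {d : ℕ} (hx : ∀ y ∈ A, y < x)
    (hA : ∀ s ∈ chains A, s.card ≤ d) :
    chainSum (insert x A) (d + 1) = chainSum A d := by
  have hxA : x ∉ A := fun h => (hx x h).false
  have h := sum_chains_through A ∅ x d 0 hx (by simp) hA (by simp +contextual [mem_chains])
  simp only [insert_empty_eq, Finset.union_singleton, add_zero, chainSum_empty, pow_zero,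
    mul_one] at h
  have h0 : ∑ s ∈ chains (insert x A) with x ∉ s,
      (X : ℤ[X]) ^ s.card * (1 - X) ^ (d + 1 - s.card) = (1 - X) * chainSum A d := by
    rw [chainSum, Finset.mul_sum]
    refine Finset.sum_congr ?_ ?_
    · ext s
      simp only [Finset.mem_filter, mem_chains, and_assoc]
      constructor
      · rintro ⟨hs, hc, hxs⟩
        exact ⟨(Finset.subset_insert_iff_of_notMem hxs).1 hs, hc⟩
      · rintro ⟨hs, hc⟩
        exact ⟨hs.trans (Finset.subset_insert _ _), hc, fun h => hxA (hs h)⟩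
    · simp only [mem_chains]
      rintro s ⟨hs, hc⟩
      rw [Nat.succ_sub (hA s (mem_chains.2 ⟨hs, hc⟩)), pow_succ]
      ring
  rw [chainSum, ← Finset.sum_filter_add_sum_filter_not _ (fun s => x ∈ s), h, h0]
  ring

/-- Splits the chains in `A` according to their least member in `T`, if there is one. -/
lemma chainSum_eq_add_sum [DecidableEq β] [DecidableLT β] {A T : Finset β} (hT : T ⊆ A)
    {d : ℕ} (d₁ d₂ : β → ℕ)
    (hd : ∀ x ∈ T, d = d₁ x + 1 + d₂ x)
    (h₁ : ∀ x ∈ T, ∀ s ∈ chains {y ∈ A \ T | y < x}, s.card ≤ d₁ x)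
    (h₂ : ∀ x ∈ T, ∀ s ∈ chains {y ∈ A | x < y}, s.card ≤ d₂ x) :
    chainSum A d = chainSum (A \ T) d +
      X * ∑ x ∈ T, chainSum {y ∈ A \ T | y < x} (d₁ x) * chainSum {y ∈ A | x < y} (d₂ x) := by
  -- The minimal member of `s ∩ T` is the least one, as `s` is a chain.
  have hdecomp : {s ∈ chains A | ¬ Disjoint s T} =
      T.biUnion fun x => {s ∈ chains (({y ∈ A \ T | y < x} : Finset β) ∪
        insert x {y ∈ A | x < y}) | x ∈ s} := by
    ext s
    simp only [Finset.mem_filter, mem_chains, Finset.mem_biUnion, and_assoc]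
    constructor
    · rintro ⟨hs, hc, hdis⟩
      obtain ⟨x, hx⟩ := (s ∩ T).exists_minimal
        (Finset.nonempty_iff_ne_empty.2 fun h => hdis (Finset.disjoint_iff_inter_eq_empty.2 h))
      obtain ⟨hxs, hxT⟩ := Finset.mem_inter.1 hx.prop
      refine ⟨x, hxT, fun y hy => ?_, hc, hxs⟩
      simp only [Finset.mem_union, Finset.mem_filter, Finset.mem_sdiff, Finset.mem_insert]
      rcases eq_or_ne y x with rfl | hne
      · exact .inr (.inl rfl)
      rcases hc.total hy hxs with h | h
      · refine .inl ⟨⟨hs hy, fun hyT => ?_⟩, lt_of_le_of_ne h hne⟩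
        exact hne (h.antisymm (hx.le_of_le (Finset.mem_inter.2 ⟨hy, hyT⟩) h))
      · exact .inr (.inr ⟨hs hy, lt_of_le_of_ne h hne.symm⟩)
    · rintro ⟨x, hxT, hs, hc, hxs⟩
      refine ⟨hs.trans fun y hy => ?_, hc, fun hdis => Finset.disjoint_left.1 hdis hxs hxT⟩
      simp only [Finset.mem_union, Finset.mem_filter, Finset.mem_sdiff, Finset.mem_insert] at hy
      rcases hy with h | rfl | h
      exacts [h.1.1, hT hxT, h.1]
  have hdisj : Set.PairwiseDisjoint (T : Set β) fun x =>
      {s ∈ chains (({y ∈ A \ T | y < x} : Finset β) ∪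
        insert x {y ∈ A | x < y}) | x ∈ s} := by
    intro x hx y hy hne
    refine Finset.disjoint_left.2 fun s hs hs' => hne ?_
    simp only [Finset.mem_filter, mem_chains, and_assoc] at hs hs'
    have key : ∀ {u v : β}, u ∈ T → u ∈ (({y ∈ A \ T | y < v} : Finset β) ∪
        insert v {y ∈ A | v < y}) → v ≤ u := by
      intro u v hu huv
      simp only [Finset.mem_union, Finset.mem_filter, Finset.mem_sdiff, Finset.mem_insert] at huv
      rcases huv with h | rfl | h
      exacts [absurd hu h.1.2, le_rfl, h.2.le]
    exact le_antisymm (key hy (hs.1 hs'.2.2)) (key hx (hs'.1 hs.2.2))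
  rw [chainSum, ← Finset.sum_filter_add_sum_filter_not _ (fun s => Disjoint s T),
    hdecomp, Finset.sum_biUnion hdisj, Finset.mul_sum]
  congr 1
  · rw [chainSum]
    refine Finset.sum_congr ?_ fun _ _ => rfl
    ext s
    simp only [Finset.mem_filter, mem_chains, Finset.subset_sdiff]
    tauto
  · refine Finset.sum_congr rfl fun x hx => ?_
    rw [← sum_chains_through _ _ x (d₁ x) (d₂ x) (by simp) (by simp) (h₁ x hx) (h₂ x hx),
      ← hd x hx]

end ChainSum

/-! ### Flats of minors and their ranks -/

namespace Matroid

variable {α : Type*} {M : Matroid α} {F G C : Set α} {i : α}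

lemma eRank_contract_add (M : Matroid α) (hC : C ⊆ M.E) :
    (M ／ C).eRank + M.eRk C = M.eRank := by
  obtain ⟨I, hI⟩ := M.exists_isBasis C
  obtain ⟨B, hB, hIB⟩ := hI.indep.exists_isBase_superset
  have hBC : B ∩ C = I := (hI.eq_of_subset_indep (hB.indep.inter_right C)
    (Set.subset_inter hIB hI.subset) Set.inter_subset_right).symm
  have hbas := hB.isBasis_ground.contract_isBasis hI
    (hB.indep.subset (Set.union_subset Set.sdiff_subset hIB))
  rw [← contract_ground, isBasis_ground_iff] at hbas
  rw [← hbas.encard_eq_eRank, ← hI.encard_eq_eRk, ← hB.encard_eq_eRank, ← hBC,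
    Set.encard_sdiff_add_encard_inter]

lemma restrict_isFlat_iff (hF : M.IsFlat F) : (M ↾ F).IsFlat G ↔ M.IsFlat G ∧ G ⊆ F := by
  rw [isFlat_iff_closure_eq, isFlat_iff_closure_eq]
  constructor
  · intro h
    have hGF : G ⊆ F := h ▸ (M ↾ F).closure_subset_ground G
    rw [restrict_closure_eq M hGF hF.subset_ground, Set.inter_eq_self_of_subset_left
      (hF.closure ▸ M.closure_subset_closure hGF)] at h
    exact ⟨h, hGF⟩
  · rintro ⟨h, hGF⟩
    rw [restrict_closure_eq M hGF hF.subset_ground, h, Set.inter_eq_self_of_subset_left hGF]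

lemma contract_isFlat_iff (hC : C ⊆ M.E) :
    (M ／ C).IsFlat G ↔ M.IsFlat (G ∪ C) ∧ Disjoint G C := by
  rw [isFlat_iff_closure_eq, contract_closure_eq, isFlat_iff_closure_eq]
  constructor
  · intro h
    refine ⟨?_, h ▸ Set.disjoint_sdiff_left⟩
    conv_rhs => rw [← h]
    rw [Set.sdiff_union_of_subset (M.subset_closure_of_subset' Set.subset_union_right hC)]
  · rintro ⟨h, hdis⟩
    rw [h, Set.union_sdiff_cancel_right hdis.inter_eq.subset]

lemma delete_singleton_isFlat_iff :
    (M ＼ {i}).IsFlat G ↔ i ∉ G ∧ M.closure G \ {i} = G := by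
  rw [isFlat_iff_closure_eq]
  constructor
  · intro h
    have hi : i ∉ G := fun hi => ((h ▸ (M ＼ {i}).closure_subset_ground G) hi).2 rfl
    rw [delete_closure_eq_of_disjoint M (Set.disjoint_singleton_right.2 hi)] at h
    exact ⟨hi, h⟩
  · rintro ⟨hi, h⟩
    rw [delete_closure_eq_of_disjoint M (Set.disjoint_singleton_right.2 hi), h]

/-- The rank of `X` in `M` as a natural number, with the junk value `0` if the rank is infinite. -/
noncomputable def finRank (M : Matroid α) (X : Set α) : ℕ := (M.eRk X).toNat

lemma coe_finRank (M : Matroid α) [M.RankFinite] (X : Set α) : (M.finRank X : ℕ∞) = M.eRk X :=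
  ENat.natCast_toNat (eRk_ne_top_iff.2 (RankFinite.isRkFinite X))

lemma finRank_mono (M : Matroid α) [M.RankFinite] (h : F ⊆ G) : M.finRank F ≤ M.finRank G := by
  rw [← Nat.cast_le (α := ℕ∞), coe_finRank, coe_finRank]
  exact M.eRk_mono h

lemma IsFlat.finRank_lt_finRank [M.RankFinite] (hF : M.IsFlat F) (hG : M.IsFlat G) (h : F ⊂ G) :
    M.finRank F < M.finRank G := by
  refine (M.finRank_mono h.subset).lt_of_ne fun heq => h.ne ?_
  have heq' : M.eRk G ≤ M.eRk F := by rw [← coe_finRank, ← coe_finRank, heq]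
  rw [← hF.closure, ← hG.closure]
  exact (RankFinite.isRkFinite F).closure_eq_closure_of_subset_of_eRk_ge_eRk h.subset heq'

lemma IsFlat.finRank_insert [M.RankFinite] (hF : M.IsFlat F) (hi : i ∈ M.E) (hiF : i ∉ F) :
    M.finRank (insert i F) = M.finRank F + 1 := by
  rw [← Nat.cast_inj (R := ℕ∞), Nat.cast_add, coe_finRank, coe_finRank,
    eRk_insert_eq_add_one ⟨hi, by rwa [hF.closure]⟩, Nat.cast_one]

lemma finRank_closure (M : Matroid α) (X : Set α) : M.finRank (M.closure X) = M.finRank X := by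
  rw [finRank, eRk_closure_eq, finRank]

lemma finRank_loops (M : Matroid α) : M.finRank M.loops = 0 := by
  rw [finRank, eRk_loops]; rfl

lemma finRank_restrict_ground (M : Matroid α) (F : Set α) :
    (M ↾ F).finRank (M ↾ F).E = M.finRank F := by
  rw [finRank, eRk_ground, eRank_restrict, finRank]

lemma finRank_contract_ground_add (M : Matroid α) [M.RankFinite] (hC : C ⊆ M.E) :
    (M ／ C).finRank (M ／ C).E + M.finRank C = M.finRank M.E := by
  rw [← Nat.cast_inj (R := ℕ∞), Nat.cast_add, coe_finRank, coe_finRank, coe_finRank, eRk_ground,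
    eRk_ground, eRank_contract_add M hC]

lemma finRank_delete_ground (h : ¬ M.IsColoop i) :
    (M ＼ {i}).finRank (M ＼ {i}).E = M.finRank M.E := by
  rw [isColoop_iff_sdiff_not_spanning, not_not] at h
  rw [finRank, finRank, eRk_ground, eRk_ground, ← restrict_compl, h.eRank_restrict]

/-- In every rank `k` up to the rank of `M` there is a flat that is the top of a chain of `k` flats,
all different from the least flat. -/
lemma exists_flat_chain (M : Matroid α) [M.RankFinite] (k : ℕ) (hk : k ≤ M.finRank M.E) :
    ∃ (F : Set α) (s : Finset (Set α)), M.IsFlat F ∧ M.finRank F = k ∧ s.card = k ∧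
      IsChain (· ≤ ·) (s : Set (Set α)) ∧ ∀ G ∈ s, M.IsFlat G ∧ G ≠ M.loops ∧ G ⊆ F := by
  classical
  induction k with
  | zero => exact ⟨M.loops, ∅, isFlat_closure ∅, M.finRank_loops, by simp⟩
  | succ k ih =>
    obtain ⟨F, s, hF, hFk, hs, hc, h⟩ := ih (by omega)
    have hlt : M.eRk F < M.eRk M.E := by
      rw [← coe_finRank, ← coe_finRank, Nat.cast_lt]; omega
    obtain ⟨e, he, -⟩ := exists_eRk_insert_eq_add_one_of_lt hlt
    have hFe : F ⊆ M.closure (insert e F) := M.subset_closure_of_subset'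
      (Set.subset_insert _ _) hF.subset_ground
    have hrk : M.finRank (M.closure (insert e F)) = k + 1 := by
      rw [finRank_closure, hF.finRank_insert he.1 he.2, hFk]
    have hns : M.closure (insert e F) ∉ s := fun hmem => by
      have := M.finRank_mono (h _ hmem).2.2
      omega
    refine ⟨M.closure (insert e F), insert (M.closure (insert e F)) s, isFlat_closure _, hrk,
      by rw [Finset.card_insert_of_notMem hns, hs], ?_, ?_⟩
    · rw [Finset.coe_insert]
      exact hc.insert fun G hG _ => .inr ((h G hG).2.2.trans hFe)
    · simp only [Finset.mem_insert, forall_eq_or_imp]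
      refine ⟨⟨isFlat_closure _, fun h0 => ?_, subset_rfl⟩,
        fun G hG => ⟨(h G hG).1, (h G hG).2.1, (h G hG).2.2.trans hFe⟩⟩
      rw [h0, finRank_loops] at hrk
      omega

/-- Ranks bound the number of members of a chain of flats strictly between `F` and `G`. -/
lemma card_add_finRank_add_one_le [M.RankFinite] (s : Finset (Set α)) (hF : M.IsFlat F)
    (hc : IsChain (· ≤ ·) (s : Set (Set α)))
    (hFG : F ⊂ G) (hG : M.IsFlat G) (h : ∀ H ∈ s, M.IsFlat H ∧ F ⊂ H ∧ H ⊂ G) :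
    s.card + M.finRank F + 1 ≤ M.finRank G := by
  -- The rank embeds the chain into the integers strictly between the two ranks.
  have hinj : Set.InjOn M.finRank (s : Set (Set α)) := by
    intro A hA B hB hAB
    by_contra hne
    rcases hc.total hA hB with hle | hle
    · exact ((h A hA).1.finRank_lt_finRank (h B hB).1 (lt_of_le_of_ne hle hne)).ne hAB
    · exact ((h B hB).1.finRank_lt_finRank (h A hA).1 (lt_of_le_of_ne hle (Ne.symm hne))).ne' hAB
  have hcard := Finset.card_le_card_of_injOn (t := Finset.Ioo (M.finRank F) (M.finRank G))
    M.finRank (fun A hA => by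
      rw [Finset.coe_Ioo]
      exact ⟨hF.finRank_lt_finRank (h A hA).1 (h A hA).2.1,
        (h A hA).1.finRank_lt_finRank hG (h A hA).2.2⟩) hinj
  rw [Nat.card_Ioo] at hcard
  have := hF.finRank_lt_finRank hG hFG
  omega

end Matroid

/-! ### The Bergman complexes of a matroid and of its minors -/

section Bergman

open scoped Classical

lemma orderComplex_allFaces (P : Type*) [PartialOrder P] :
    (orderComplex P).allFaces = {s | IsChain (· ≤ ·) ((s : Finset P) : Set P)} := by
  ext s
  rcases s.eq_empty_or_nonempty with rfl | hs
  · simp [AbstractSimplicialComplex.allFaces]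
  · simp [AbstractSimplicialComplex.allFaces, orderComplex, hs, hs.ne_empty]

lemma hPolynomial_orderComplex (P : Type*) [PartialOrder P] [Fintype P] {d : ℕ}
    (hd : IsGreatest (Finset.card '' (orderComplex P).allFaces) d) :
    (orderComplex P).hPolynomial = chainSum (Finset.univ : Finset P) d := by
  have hdim : (orderComplex P).dimSucc = d := hd.csSup_eq
  have hf (k : ℕ) : (orderComplex P).fNumber k =
      {s ∈ chains (Finset.univ : Finset P) | s.card = k}.card := by
    rw [AbstractSimplicialComplex.fNumber, ← Set.ncard_coe_finset, orderComplex_allFaces]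
    congr 1
    ext s
    simp [mem_chains]
  rw [AbstractSimplicialComplex.hPolynomial, hdim, chainSum,
    ← Finset.sum_fiberwise_of_maps_to (t := Finset.range (d + 1)) (g := Finset.card)]
  · refine Finset.sum_congr rfl fun k _ => ?_
    rw [hf, Finset.sum_congr rfl (g := fun _ => X ^ k * (1 - X) ^ (d - k))]
    · simp [mul_assoc]
    · intro s hs
      rw [(Finset.mem_filter.1 hs).2]
  · intro s hs
    rw [Finset.mem_range_succ_iff]
    exact hd.2 ⟨s, by rw [orderComplex_allFaces]; exact (mem_chains.1 hs).2, rfl⟩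

namespace Matroid

variable {α : Type*} {M : Matroid α} {F G C : Set α} {i : α}

lemma finite_properFlats (M : Matroid α) [M.Finite] :
    {F | M.IsFlat F ∧ F ≠ M.loops ∧ F ≠ M.E}.Finite :=
  M.ground_finite.finite_subsets.subset fun _ hF => hF.1.subset_ground

/-- The proper part of the lattice of flats, as a finite set of subsets of the ground set. -/
noncomputable def properFlats (M : Matroid α) [M.Finite] : Finset (Set α) :=
  M.finite_properFlats.toFinset

lemma mem_properFlats [M.Finite] :
    F ∈ M.properFlats ↔ M.IsFlat F ∧ F ≠ M.loops ∧ F ≠ M.E := by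
  simp [properFlats]

lemma card_le_of_mem_chains_properFlats [M.Finite] {s : Finset (Set α)}
    (hs : s ∈ chains M.properFlats) : s.card ≤ M.finRank M.E - 1 := by
  obtain ⟨hs, hc⟩ := mem_chains.1 hs
  rcases s.eq_empty_or_nonempty with rfl | ⟨H, hH⟩
  · simp
  have h : ∀ H ∈ s, M.IsFlat H ∧ M.loops ⊂ H ∧ H ⊂ M.E := fun H hH => by
    obtain ⟨hF, h0, h1⟩ := mem_properFlats.1 (hs hH)
    exact ⟨hF, hF.loops_subset.ssubset_of_ne h0.symm, hF.subset_ground.ssubset_of_ne h1⟩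
  have := card_add_finRank_add_one_le s (isFlat_closure ∅) hc ((h H hH).2.1.trans (h H hH).2.2)
    M.ground_isFlat h
  omega

theorem bergmanHPolynomial_eq_chainSum (M : Matroid α) [M.Finite] :
    M.bergmanHPolynomial = chainSum M.properFlats (M.finRank M.E - 1) := by
  have : Finite M.ProperFlat := M.finite_properFlats.to_subtype
  have : Fintype M.ProperFlat := Fintype.ofFinite _
  have himage : M.properFlats = Finset.univ.image (Subtype.val : M.ProperFlat → Set α) := by
    ext F
    simp [mem_properFlats]
  rw [himage, chainSum_image (by simp), bergmanHPolynomial, bergmanComplex]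
  refine hPolynomial_orderComplex _ ⟨?_, ?_⟩
  · rw [orderComplex_allFaces]
    -- A chain reaching rank one less than full consists of proper flats, so the bound is attained.
    obtain ⟨F, s, hF, hFk, hs, hc, h⟩ := M.exists_flat_chain (M.finRank M.E - 1) (Nat.sub_le _ _)
    have hs' : ∀ G ∈ s, M.IsFlat G ∧ G ≠ M.loops ∧ G ≠ M.E := by
      refine fun G hG => ⟨(h G hG).1, (h G hG).2.1, ?_⟩
      rintro rfl
      have h1 := M.finRank_mono (h _ hG).2.2
      have h2 := (h _ hG).1.loops_subset.ssubset_of_ne (h _ hG).2.1.symm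
      have h3 := IsFlat.finRank_lt_finRank (isFlat_closure ∅) M.ground_isFlat h2
      omega
    refine ⟨s.subtype _, ?_, by rw [Finset.card_subtype, Finset.filter_true_of_mem hs', hs]⟩
    intro x hx y hy hne
    exact hc (Finset.mem_subtype.1 hx) (Finset.mem_subtype.1 hy) fun h => hne (Subtype.ext h)
  · rintro _ ⟨s, hs, rfl⟩
    rw [orderComplex_allFaces] at hs
    rw [← Finset.card_image_of_injective s Subtype.val_injective]
    refine card_le_of_mem_chains_properFlats (mem_chains.2 ⟨?_, ?_⟩)
    · rw [himage]
      exact Finset.image_subset_image (Finset.subset_univ s)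
    · rintro _ hx _ hy hne
      obtain ⟨x, hxs, rfl⟩ := Finset.mem_image.1 hx
      obtain ⟨y, hys, rfl⟩ := Finset.mem_image.1 hy
      exact hs hxs hys fun h => hne (h ▸ rfl)

/-- The proper flats of `M ／ C` correspond to the proper flats of `M` strictly above `C`. -/
lemma IsFlat.bergmanHPolynomial_contract [M.Finite] (hC : M.IsFlat C) :
    (M ／ C).bergmanHPolynomial =
      chainSum {G ∈ M.properFlats | C < G} (M.finRank M.E - M.finRank C - 1) := by
  have hrk := finRank_contract_ground_add M hC.subset_ground
  have hloops : (M ／ C).loops = ∅ := by rw [contract_loops_eq, hC.closure, sdiff_self]; rfl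
  rw [bergmanHPolynomial_eq_chainSum, ← chainSum_image (f := fun G => G ∪ C), ← hrk,
    Nat.add_sub_cancel]
  · congr 1
    ext G
    simp only [Finset.mem_image, Finset.mem_filter, mem_properFlats,
      contract_isFlat_iff hC.subset_ground, hloops, contract_ground]
    constructor
    · rintro ⟨H, ⟨⟨hH, hdis⟩, hne, hneE⟩, rfl⟩
      have hlt : C ⊂ H ∪ C := Set.subset_union_right.ssubset_of_ne fun h => hne
        (_root_.disjoint_self.1 (hdis.mono_right (Set.union_eq_right.1 h.symm)))
      refine ⟨⟨hH, fun h => ?_, fun h => hneE ?_⟩, hlt⟩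
      · rw [h] at hlt
        exact hlt.not_subset hC.loops_subset
      · rw [← h, Set.union_sdiff_cancel_right hdis.inter_eq.subset]
    · rintro ⟨⟨hG, h0, hE⟩, hCG⟩
      refine ⟨G \ C, ⟨⟨?_, Set.disjoint_sdiff_left⟩, ?_, fun h => hE ?_⟩,
        Set.sdiff_union_of_subset hCG.le⟩
      · rwa [Set.sdiff_union_of_subset hCG.le]
      · exact fun h => hCG.not_ge (Set.sdiff_eq_empty.1 h)
      · rw [← Set.sdiff_union_of_subset hCG.le, h, Set.sdiff_union_of_subset hC.subset_ground]
  · simp only [mem_properFlats, contract_isFlat_iff hC.subset_ground]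
    rintro G ⟨⟨-, hG⟩, -⟩ H -
    refine ⟨fun h x hx => ?_, fun h => Set.union_subset_union_left C h⟩
    exact (h (.inl hx)).resolve_right (Set.disjoint_left.1 hG hx)

/-- The `h`-polynomial of `M ↾ F` may be computed from the set `A` of all nonempty flats contained
in `F`, in place of the proper ones: if `F` is nonempty, then `A` is a cone with apex `F` over the
proper flats, and if `F` is empty, then so is `A`. -/
lemma IsFlat.bergmanHPolynomial_restrict [M.Finite] [M.Loopless] (hF : M.IsFlat F)
    {A : Finset (Set α)} (hA : ∀ G, G ∈ A ↔ M.IsFlat G ∧ G ≠ ∅ ∧ G ⊆ F) :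
    (M ↾ F).bergmanHPolynomial = chainSum A (M.finRank F) := by
  have : (M ↾ F).Finite := restrict_finite (M.ground_finite.subset hF.subset_ground)
  have hloops : (M ↾ F).loops = ∅ := by
    rw [← closure_empty, restrict_closure_eq M (Set.empty_subset F) hF.subset_ground,
      closure_empty, loops_eq_empty, Set.empty_inter]
  rw [bergmanHPolynomial_eq_chainSum, finRank_restrict_ground]
  have hmem (G : Set α) :
      G ∈ (M ↾ F).properFlats ↔ (M.IsFlat G ∧ G ⊆ F) ∧ G ≠ ∅ ∧ G ≠ F := by
    rw [mem_properFlats, restrict_isFlat_iff hF, hloops, restrict_ground_eq]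
  rcases eq_or_ne F ∅ with rfl | hne
  · have h1 : (M ↾ (∅ : Set α)).properFlats = ∅ := by
      ext G
      simp only [hmem, Set.subset_empty_iff, Finset.notMem_empty, iff_false]
      tauto
    have h2 : A = ∅ := by
      ext G
      simp only [hA, Set.subset_empty_iff, Finset.notMem_empty, iff_false]
      tauto
    have h3 : M.finRank ∅ = 0 := by rw [← M.loops_eq_empty, finRank_loops]
    rw [h1, h2, h3]
  · have hAeq : A = insert F (M ↾ F).properFlats := by
      ext G
      simp only [hA, Finset.mem_insert, hmem]
      constructor
      · rintro ⟨hG, h0, hGF⟩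
        rcases eq_or_ne G F with h | h
        exacts [.inl h, .inr ⟨⟨hG, hGF⟩, h0, h⟩]
      · rintro (rfl | ⟨⟨hG, hGF⟩, h0, -⟩)
        exacts [⟨hF, hne, subset_rfl⟩, ⟨hG, h0, hGF⟩]
    have hpos : 0 < M.finRank F := by
      have := IsFlat.finRank_lt_finRank (isFlat_closure ∅) hF
        (hF.loops_subset.ssubset_of_ne (by rwa [M.loops_eq_empty, ne_comm]))
      omega
    obtain ⟨r, hr⟩ : ∃ r, M.finRank F = r + 1 := ⟨M.finRank F - 1, by omega⟩
    rw [hAeq, hr, Nat.add_sub_cancel, chainSum_insert_top]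
    · intro G hG
      exact ((hmem G).1 hG).1.2.ssubset_of_ne ((hmem G).1 hG).2.2
    · intro s hs
      have := card_le_of_mem_chains_properFlats hs
      rwa [finRank_restrict_ground, hr, Nat.add_sub_cancel] at this

/-- Taking closures in `M` is an order isomorphism from the proper flats of `M ＼ {i}` onto the
proper flats `G` of `M` that are the closure of `G \ {i}`. -/
lemma bergmanHPolynomial_delete [M.Finite] [M.Loopless] (hi : ¬ M.IsColoop i)
    {A : Finset (Set α)} (hA : ∀ G, G ∈ A ↔ G ∈ M.properFlats ∧ M.closure (G \ {i}) = G) :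
    (M ＼ {i}).bergmanHPolynomial = chainSum A (M.finRank M.E - 1) := by
  have hloops : (M ＼ {i}).loops = ∅ := by
    rw [← closure_empty, delete_closure_eq, Set.empty_sdiff, closure_empty, loops_eq_empty,
      Set.empty_sdiff]
  have hE : M.closure (M.E \ {i}) = M.E := by
    rwa [isColoop_iff_sdiff_closure, not_not] at hi
  rw [bergmanHPolynomial_eq_chainSum, finRank_delete_ground hi, ← chainSum_image (f := M.closure)]
  · congr 1
    ext G
    simp only [Finset.mem_image, hA, mem_properFlats, delete_singleton_isFlat_iff, hloops,
      delete_ground, loops_eq_empty]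
    constructor
    · rintro ⟨H, ⟨⟨-, hH⟩, hne, hneE⟩, rfl⟩
      refine ⟨⟨isFlat_closure H, fun h => hne ?_, fun h => hneE ?_⟩, by rw [hH]⟩
      · rw [← hH, h, Set.empty_sdiff]
      · rw [← hH, h]
    · rintro ⟨⟨hG, h0, hne⟩, hcl⟩
      refine ⟨G \ {i}, ⟨⟨fun h => h.2 rfl, by rw [hcl]⟩, fun h => h0 ?_, fun h => hne ?_⟩, hcl⟩
      · rw [← hcl, h, closure_empty, loops_eq_empty]
      · rw [← hcl, h, hE]
  · simp only [mem_properFlats, delete_singleton_isFlat_iff]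
    rintro G ⟨⟨-, hG⟩, -⟩ H ⟨⟨-, hH⟩, -⟩
    refine ⟨fun h => ?_, fun h => M.closure_subset_closure h⟩
    rw [← hG, ← hH]
    exact Set.sdiff_subset_sdiff_left h

lemma IsFlat.closure_sdiff_singleton_eq_iff (hG : M.IsFlat G) :
    M.closure (G \ {i}) = G ↔ ¬ (i ∈ G ∧ M.IsFlat (G \ {i})) := by
  constructor
  · rintro h ⟨hi, hflat⟩
    rw [hflat.closure] at h
    exact (h.ge hi).2 rfl
  · intro h
    by_cases hi : i ∈ G
    · have hsub : G \ {i} ⊆ M.closure (G \ {i}) :=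
        M.subset_closure _ (Set.sdiff_subset.trans hG.subset_ground)
      have hle : M.closure (G \ {i}) ⊆ G :=
        (M.closure_subset_closure Set.sdiff_subset).trans hG.closure.subset
      have hicl : i ∈ M.closure (G \ {i}) := by
        by_contra hicl
        refine h ⟨hi, ?_⟩
        rw [isFlat_iff_closure_eq]
        exact (Set.subset_sdiff_singleton hle hicl).antisymm hsub
      refine hle.antisymm ?_
      exact (Set.insert_sdiff_self_of_mem hi).ge.trans (Set.insert_subset hicl hsub)
    · rw [Set.sdiff_singleton_eq_self hi, hG.closure]

/-- If `G \ {i}` is contained in a flat avoiding `i`, then its closure avoids `i` as well and is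
therefore no larger than `G \ {i}`. -/
lemma IsFlat.isFlat_sdiff_singleton_of_subset (hG : M.IsFlat G) (hF : M.IsFlat F) (hiF : i ∉ F)
    (hGF : G \ {i} ⊆ F) : M.IsFlat (G \ {i}) := by
  have hle : M.closure (G \ {i}) ⊆ G :=
    (M.closure_subset_closure Set.sdiff_subset).trans hG.closure.subset
  rw [isFlat_iff_closure_eq]
  refine (Set.subset_sdiff_singleton hle fun h => hiF ?_).antisymm
    (M.subset_closure _ (Set.sdiff_subset.trans hG.subset_ground))
  exact hF.closure ▸ M.closure_subset_closure hGF h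

end Matroid

end Bergman

open Matroid in
theorem mainTheorem10 {α : Type*} (M : Matroid α) [M.Finite] [M.Loopless] (i : α)
    (hi : i ∈ M.E) (hcoloop : ¬ M.IsColoop i) :
    M.bergmanHPolynomial =
      (M ＼ {i}).bergmanHPolynomial +
        X * ∑ F ∈ (M.finite_deletionFlats i).toFinset,
          (M ↾ F).bergmanHPolynomial * (M ／ (insert i F)).bergmanHPolynomial := by
  classical
  obtain ⟨T, hT⟩ : ∃ T, T = (M.finite_deletionFlats i).toFinset.image (insert i) := ⟨_, rfl⟩
  have hF : ∀ F ∈ (M.finite_deletionFlats i).toFinset,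
      M.IsFlat F ∧ i ∉ F ∧ M.IsFlat (insert i F) := fun F h => by
    simpa [deletionFlats] using h
  have hinj : Set.InjOn (insert i) ((M.finite_deletionFlats i).toFinset : Set (Set α)) := by
    intro F h G h' heq
    have heq' := congrArg (· \ {i}) heq
    simpa only [Set.insert_sdiff_self_of_notMem (hF F h).2.1,
      Set.insert_sdiff_self_of_notMem (hF G h').2.1] using heq'
  -- `T` consists of the exceptional flats.
  have hmemT : ∀ G, G ∈ T ↔ M.IsFlat G ∧ i ∈ G ∧ M.IsFlat (G \ {i}) := by
    intro G
    simp only [hT, Finset.mem_image]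
    constructor
    · rintro ⟨F, h, rfl⟩
      obtain ⟨h1, h2, h3⟩ := hF F h
      refine ⟨h3, Set.mem_insert i F, ?_⟩
      rwa [Set.insert_sdiff_self_of_notMem h2]
    · rintro ⟨h1, h2, h3⟩
      refine ⟨G \ {i}, ?_, Set.insert_sdiff_self_of_mem h2⟩
      simp only [deletionFlats, Set.Finite.mem_toFinset, Set.mem_ofPred_eq]
      exact ⟨h3, fun h => h.2 rfl, by rwa [Set.insert_sdiff_self_of_mem h2]⟩
  -- The ground set is not exceptional, because `M.E \ {i}` spans.
  have hne : ∀ G ∈ T, G ≠ M.E := by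
    rintro _ hG rfl
    rw [isColoop_iff_sdiff_closure, not_not] at hcoloop
    have h := ((hmemT _).1 hG).2.2.closure
    rw [hcoloop] at h
    exact (h.le hi).2 rfl
  have hTA : T ⊆ M.properFlats := fun G hG => by
    refine mem_properFlats.2 ⟨((hmemT G).1 hG).1, ?_, hne G hG⟩
    rw [loops_eq_empty]
    exact Set.nonempty_iff_ne_empty.1 ⟨i, ((hmemT G).1 hG).2.1⟩
  have hrk : ∀ G ∈ T, M.finRank G = M.finRank (G \ {i}) + 1 := fun G hG => by
    obtain ⟨-, h2, h3⟩ := (hmemT G).1 hG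
    rw [← h3.finRank_insert hi (fun h => h.2 rfl), Set.insert_sdiff_self_of_mem h2]
  -- Below `F ∪ {i}`, the non-exceptional flats are exactly those avoiding `i`.
  have hbelow : ∀ F ∈ (M.finite_deletionFlats i).toFinset, ∀ G,
      G ∈ ({H ∈ M.properFlats \ T | H < insert i F} : Finset (Set α)) ↔
        M.IsFlat G ∧ G ≠ ∅ ∧ G ⊆ F := by
    intro F h G
    obtain ⟨h1, h2, h3⟩ := hF F h
    simp only [Finset.mem_filter, Finset.mem_sdiff, mem_properFlats, loops_eq_empty, hmemT]
    constructor
    · rintro ⟨⟨⟨hG, h0, -⟩, hGT⟩, hlt⟩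
      have hGF : G \ {i} ⊆ F := Set.sdiff_singleton_subset_iff.2 hlt.le
      have hiG : i ∉ G := fun hiG =>
        hGT ⟨hG, hiG, hG.isFlat_sdiff_singleton_of_subset h1 h2 hGF⟩
      exact ⟨hG, h0, by rwa [Set.sdiff_singleton_eq_self hiG] at hGF⟩
    · rintro ⟨hG, h0, hGF⟩
      have hlt : G < insert i F := hGF.trans_ssubset (Set.ssubset_insert h2)
      exact ⟨⟨⟨hG, h0, fun h => (h ▸ hlt).not_ge h3.subset_ground⟩,
        fun h => h2 (hGF h.2.1)⟩, hlt⟩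
  rw [bergmanHPolynomial_eq_chainSum, chainSum_eq_add_sum hTA (fun G => M.finRank (G \ {i}))
    (fun G => M.finRank M.E - M.finRank G - 1)]
  · refine congrArg₂ (· + ·) ?_ (congrArg (X * ·) ?_)
    · refine (bergmanHPolynomial_delete hcoloop fun G => ?_).symm
      rw [Finset.mem_sdiff, hmemT]
      refine and_congr_right fun hG => ?_
      have hG' := (mem_properFlats.1 hG).1
      rw [hG'.closure_sdiff_singleton_eq_iff, and_iff_right hG']
    · refine (Finset.sum_congr hT fun _ _ => rfl).trans
        ((Finset.sum_image hinj).trans (Finset.sum_congr rfl fun F h => ?_))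
      obtain ⟨h1, h2, h3⟩ := hF F h
      rw [h1.bergmanHPolynomial_restrict (hbelow F h), h3.bergmanHPolynomial_contract,
        Set.insert_sdiff_self_of_notMem h2]
  · intro G hG
    have h1 := hrk G hG
    have hG' := ((hmemT G).1 hG).1
    have h2 := hG'.finRank_lt_finRank M.ground_isFlat (hG'.subset_ground.ssubset_of_ne (hne G hG))
    omega
  · intro G hG s hs
    obtain ⟨F, h, rfl⟩ := Finset.mem_image.1 (hT ▸ hG)
    obtain ⟨h1, h2, h3⟩ := hF F h
    obtain ⟨hs, hc⟩ := mem_chains.1 hs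
    have hempty : M.IsFlat ∅ := M.loops_eq_empty ▸ isFlat_closure ∅
    have := card_add_finRank_add_one_le s hempty hc
      (Set.empty_ssubset.2 ⟨i, Set.mem_insert i F⟩) h3 fun H hH => by
        obtain ⟨hH1, hH2, hH3⟩ := (hbelow F h H).1 (hs hH)
        exact ⟨hH1, Set.empty_ssubset.2 (Set.nonempty_iff_ne_empty.2 hH2),
          hH3.trans_ssubset (Set.ssubset_insert h2)⟩
    have := hrk _ hG
    omega
  · intro G hG s hs
    obtain ⟨hs, hc⟩ := mem_chains.1 hs
    have hG' := ((hmemT G).1 hG).1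
    have := card_add_finRank_add_one_le s hG' hc (hG'.subset_ground.ssubset_of_ne (hne G hG))
      M.ground_isFlat fun H hH => by
        obtain ⟨hHA, hlt⟩ := Finset.mem_filter.1 (hs hH)
        obtain ⟨hH1, -, hH2⟩ := mem_properFlats.1 hHA
        exact ⟨hH1, hlt, hH1.subset_ground.ssubset_of_ne hH2⟩
    omega
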